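/- Throughout, functions have the form $f:\{0,1\}^n\to\mathbb{C}$ with arity $n\ge 1$ and algebraic values; $f$ is non-negative if all its values are (algebraic) non-negative real numbers. Let $\mathrm{supp}(f)=\{\mathbf{x}: f(\mathbf{x})\neq 0\}$, and identify $\{0,1\}$ with $\mathbb{Z}_2$ where needed. A function $f$ of arity $n$ is \emph{affine} if $\mathrm{supp}(f)$ is the (possibly empty) solution set of a system of linear equations over $\mathbb{Z}_2$ and there are an algebraic $\lambda\in\mathbb{C}$, $a_i\in\mathbb{Z}_4$ and $b_{ij}\in\{0,1\}$ such that $f(\mathbf{x})=\lambda\cdot \mathrm{i}^{\,\sum_i a_ix_i^2+2\sum_{i<j}b_{ij}x_ix_j}$ for all $\mathbf{x}\in\mathrm{supp}(f)$, where $\mathrm{i}=\sqrt{-1}$. It is of \emph{product type} if it is a finite product of unary functions of single variables and of binary equality functions $[x_i=x_j]$ and disequality functions $[x_i\ne x_j]$ of pairs of variables (which may overlap). Let $\mathscr{A}$ and $\mathscr{P}$ be the sets of all affine functions and of all functions of product type. Let $\mathcal{F}$ be a (possibly infinite) set of non-negative functions. An instance of $\mathrm{Holant}(\mathcal{F})$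 (a read-twice $\#\mathrm{CSP}(\mathcal{F})$ instance) consists of numbered variables $x_1,\dots,x_n$ and finitely many constraints $(F_i,\mathbf{x}_i)$, $i=1,\dots,m$, repetitions allowed, where $F_i\in\mathcal{F}$ and $\mathbf{x}_i$ is a tuple of $\mathrm{arity}(F_i)$ not necessarily distinct variables, such that every variable occurs exactly twice in total. It defines the function $F(x_1,\dots,x_n)=\prod_{i=1}^m F_i(\mathbf{x}_i)$. For $1\le t\le n$ put $$F^{[t]}(x_1,\dots,x_t)=\sum_{x_{t+1},\dots,x_n\in\{0,1\}}F(x_1,\dots,x_n),$$ and let $\mathcal{W}_{\mathcal{F}}$ be the set of all functions $F^{[t]}$ obtained in this way. A non-negative function $g$ of arity $k$ is \emph{block-rank-one} if $k=1$, or if every two rows of the $2^{k-1}\times 2$ matrix $M_{[k-1]}(g)=\big(g(\mathbf{x},y)\big)_{\mathbf{x}\in\{0,1\}^{k-1},\,y\in\{0,1\}}$ are linearly dependent or orthogonal. The set $\mathcal{F}$ satisfies the \emph{Block-rank-one condition} if every function in $\mathcal{W}_{\mathcal{F}}$ is block-rank-one. \textbf{Statement.} Let $\mathcal{F}$ be a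 set of non-negative functions. If $\mathcal{F}$ satisfies the Block-rank-one condition, then $\mathcal{F}\subseteq\mathscr{A}$ or $\mathcal{F}\subseteq\mathscr{P}$. -/

import Mathlib

open scoped BigOperators

namespace Holant

/-- A function `{0,1}^n → ℂ` together with its arity `n`.  The Boolean domain `{0,1}` is `ZMod 2`. -/
structure BoolFn where
  arity : ℕ
  val : (Fin arity → ZMod 2) → ℂ

/-- All values are non-negative algebraic real numbers. -/
def BoolFn.NonNeg (f : BoolFn) : Prop :=
  ∀ x, IsAlgebraic ℚ (f.val x) ∧ ∃ r : ℝ, 0 ≤ r ∧ f.val x = (r : ℂ)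

/-! ### Instances of `Holant(F)` and the functions they define -/

/-- An instance of `Holant(F)`, that is, a read-twice `#CSP(F)` instance: finitely many numbered
variables (the edges of the signature grid) and finitely many constraints (its vertices), each
applying a function of `F` to a tuple of not necessarily distinct variables, such that every
variable occurs exactly twice in total. -/
structure Instance (F : Set BoolFn) where
  numVars : ℕ
  numCons : ℕ
  fn : Fin numCons → BoolFn
  fn_mem : ∀ c, fn c ∈ F
  scope : ∀ c, Fin (fn c).arity → Fin numVars
  read_twice : ∀ v : Fin numVars,
    Fintype.card {p : (c : Fin numCons) × Fin (fn c).arity // scope p.1 p.2 = v} = 2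

/-- The function defined by an instance: the product of all its constraints. -/
def Instance.toFn {F : Set BoolFn} (I : Instance F) (x : Fin I.numVars → ZMod 2) : ℂ :=
  ∏ c, (I.fn c).val (fun k => x (I.scope c k))

/-- `f^{[t]}`: sum `f` over all its variables but the first `t`, i.e. the value at `x` is the sum of
`f z` over all `z` whose first `t` entries are `x`. -/
def sumOut {n : ℕ} (f : (Fin n → ZMod 2) → ℂ) (t : ℕ) (ht : t ≤ n) (x : Fin t → ZMod 2) : ℂ :=
  ∑ z ∈ Finset.univ.filter (fun z : Fin n → ZMod 2 => ∀ i, z (Fin.castLE ht i) = x i), f z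

/-- The set `𝓦_F` of all `G^{[t]}`, where `G` is defined by an instance of `Holant(F)` and
`1 ≤ t ≤ arity G`. -/
def summedOut (F : Set BoolFn) : Set BoolFn :=
  {g | ∃ (I : Instance F) (t : ℕ) (ht : t ≤ I.numVars), 1 ≤ t ∧ g = ⟨t, sumOut I.toFn t ht⟩}

/-! ### The Block-rank-one condition -/

/-- The signature matrix `M_{[r]}(f)`: rows are indexed by the first `r` inputs, columns by the
remaining ones. -/
def sigMatrix {n : ℕ} (f : (Fin n → ZMod 2) → ℂ) (r : ℕ) :
    Matrix (Fin r → ZMod 2) (Fin (n - r) → ZMod 2) ℂ :=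
  fun x y => f fun i => if h : (i : ℕ) < r then x ⟨i, h⟩ else y ⟨i - r, by omega⟩

/-- Every two rows are linearly dependent or orthogonal.  (Used for non-negative matrices only.) -/
def MatrixBlockRankOne {m n : Type*} [Fintype n] (M : Matrix m n ℂ) : Prop :=
  ∀ u v : m, ¬ LinearIndependent ℂ ![M u, M v] ∨ M u ⬝ᵥ M v = 0

/-- `f` is unary, or `M_{[n-1]}(f)` is block-rank-one, where `n` is the arity of `f`. -/
def IsBlockRankOne {n : ℕ} (f : (Fin n → ZMod 2) → ℂ) : Prop :=
  n = 1 ∨ MatrixBlockRankOne (sigMatrix f (n - 1))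

/-- The Block-rank-one condition on a set of functions. -/
def BlockRankOneCondition (F : Set BoolFn) : Prop :=
  ∀ g ∈ summedOut F, IsBlockRankOne g.val

/-! ### Affine functions -/

/-- The support of a function. -/
def supp {n : ℕ} (f : (Fin n → ZMod 2) → ℂ) : Set (Fin n → ZMod 2) := {x | f x ≠ 0}

/-- A Boolean relation is affine if it is the solution set of a system of linear equations over
`ZMod 2` (it may be empty). -/
def IsAffineRel {n : ℕ} (S : Set (Fin n → ZMod 2)) : Prop :=
  ∃ (m : ℕ) (A : Matrix (Fin m) (Fin n) (ZMod 2)) (b : Fin m → ZMod 2), S = {x | A.mulVec x = b}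

/-- The quadratic form `∑ i, a i * x i ^ 2 + 2 * ∑ i < j, b i j * x i * x j`, with `a i ∈ {0,1,2,3}`
and `b i j, x i ∈ {0,1}` lifted to natural numbers; only its class modulo `4` matters. -/
def quadForm {n : ℕ} (a : Fin n → ZMod 4) (b : Fin n → Fin n → ZMod 2) (x : Fin n → ZMod 2) : ℕ :=
  (∑ i, (a i).val * (x i).val ^ 2) +
    2 * ∑ p ∈ Finset.univ.filter (fun p : Fin n × Fin n => p.1 < p.2),
      (b p.1 p.2).val * (x p.1).val * (x p.2).val

/-- Affine functions. -/
def IsAffine {n : ℕ} (f : (Fin n → ZMod 2) → ℂ) : Prop :=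
  IsAffineRel (supp f) ∧
    ∃ (c : ℂ) (a : Fin n → ZMod 4) (b : Fin n → Fin n → ZMod 2),
      IsAlgebraic ℚ c ∧ ∀ x ∈ supp f, f x = c * Complex.I ^ quadForm a b x

/-- The class `𝒜` of affine functions. -/
def affineClass : Set BoolFn := {f | IsAffine f.val}

/-! ### Product-type functions -/

/-- The possible factors of a product-type function in `n` variables: an (algebraic-valued) unary
function of one variable, or an equality or disequality of two variables. -/
inductive Factor (n : ℕ) : Type
  | unary (i : Fin n) (u : ZMod 2 → ℂ) (hu : ∀ s, IsAlgebraic ℚ (u s)) : Factor n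
  | eq (i j : Fin n) (hij : i ≠ j) : Factor n
  | ne (i j : Fin n) (hij : i ≠ j) : Factor n

/-- The value of a factor at an assignment. -/
def Factor.eval {n : ℕ} (x : Fin n → ZMod 2) : Factor n → ℂ
  | .unary i u _ => u (x i)
  | .eq i j _ => if x i = x j then 1 else 0
  | .ne i j _ => if x i ≠ x j then 1 else 0

/-- Functions of product type. -/
def IsProductType {n : ℕ} (f : (Fin n → ZMod 2) → ℂ) : Prop :=
  ∃ L : List (Factor n), ∀ x, f x = (L.map (Factor.eval x)).prod

/-- The class `𝒫` of functions of product type. -/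
def productClass : Set BoolFn := {f | IsProductType f.val}

end Holant

/-! Two copies of `f` on the same variables form an instance, so all marginals of `f²` are
block-rank-one (`BlockRankOneCondition.sq`). Add the coordinates of a nonzero `f²` one at a time. A
row with two positive entries is orthogonal to no nonzero row, so a coordinate `t` not determined by
the earlier ones is independent of them and contributes a positive unary weight. Otherwise `t` is
the parity of a minimal determining set `D`, up to a constant (`MargBlockRankOne.marg_insert`). Thus
`f²` is a constant times unary weights and parity indicators.

If no coordinate is skewed, the weights are constant and `f` is constant on an affine support. If no
parity has `#D ≥ 2` (no circuit), all indicators are pinnings, equalities or disequalities, and the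
square root `f` is of product type.

It remains to exclude a skewed variable `b` of one function together with a circuit on `D` in
another, possibly the same one. `crossover` forces `b` to equal the parity of `D`, so the marginal
on `D` becomes that of the second square times `P(c + ∑ D)`, with `P` the marginal of `b`. A
vanishing 2×2 minor then gives `P(c)² = P(c+1)²`, contradicting skewness
(`not_margBlockRankOne_crossover`). -/

namespace Holant

open Finset Function

/-! ### Marginals of a non-negative function: independence or parity -/

section Marginals

variable {V : Type*} [Fintype V] [DecidableEq V]

/-- The marginal of `h` on the coordinates in `S`, as a function of a full assignment. -/
def marg (h : (V → ZMod 2) → ℝ) (S : Finset V) (x : V → ZMod 2) : ℝ :=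
  ∑ z ∈ univ.filter (fun z : V → ZMod 2 => ∀ v ∈ S, z v = x v), h z

/-- The rows of all marginals, with one distinguished coordinate as column index, are pairwise
proportional or orthogonal. -/
def MargBlockRankOne (h : (V → ZMod 2) → ℝ) : Prop :=
  ∀ (S : Finset V) (t : V), t ∉ S → ∀ x y : V → ZMod 2,
    marg h (insert t S) (update x t 0) * marg h (insert t S) (update y t 1) =
        marg h (insert t S) (update x t 1) * marg h (insert t S) (update y t 0) ∨
      ∀ s, marg h (insert t S) (update x t s) * marg h (insert t S) (update y t s) = 0

/-- The coordinate `t` is determined by the coordinates in `S` on the support of `h`. -/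
def Determined (h : (V → ZMod 2) → ℝ) (S : Finset V) (t : V) : Prop :=
  ∀ x, marg h (insert t S) (update x t 0) * marg h (insert t S) (update x t 1) = 0

/-- The marginal of `h` at `b` charges both values, but not equally. -/
def IsSkewed (h : (V → ZMod 2) → ℝ) (b : V) : Prop :=
  marg h {b} (fun _ => 0) ≠ 0 ∧ marg h {b} (fun _ => 1) ≠ 0 ∧
    marg h {b} (fun _ => 0) ≠ marg h {b} (fun _ => 1)

theorem marg_nonneg {h : (V → ZMod 2) → ℝ} (h0 : ∀ x, 0 ≤ h x) (S : Finset V) (x : V → ZMod 2) :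
    0 ≤ marg h S x :=
  sum_nonneg fun _ _ => h0 _

theorem marg_congr (h : (V → ZMod 2) → ℝ) {S : Finset V} {x y : V → ZMod 2}
    (hxy : ∀ v ∈ S, x v = y v) : marg h S x = marg h S y := by
  unfold marg
  congr 1
  ext z
  simp only [mem_filter, mem_univ, true_and]
  exact forall₂_congr fun v hv => by rw [hxy v hv]

theorem marg_univ (h : (V → ZMod 2) → ℝ) (x : V → ZMod 2) : marg h univ x = h x := by
  have : univ.filter (fun z : V → ZMod 2 => ∀ v ∈ univ, z v = x v) = {x} := by
    ext z
    simp [funext_iff]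
  rw [marg, this, sum_singleton]

theorem marg_anti {h : (V → ZMod 2) → ℝ} (h0 : ∀ x, 0 ≤ h x) {S T : Finset V} (hST : S ⊆ T)
    (x : V → ZMod 2) : marg h T x ≤ marg h S x := by
  refine sum_le_sum_of_subset_of_nonneg (fun z hz => ?_) fun _ _ _ => h0 _
  simp only [mem_filter, mem_univ, true_and] at hz ⊢
  exact fun v hv => hz v (hST hv)

theorem marg_pos {h : (V → ZMod 2) → ℝ} (h0 : ∀ x, 0 ≤ h x) {x : V → ZMod 2} (hx : h x ≠ 0)
    (S : Finset V) : 0 < marg h S x := by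
  refine lt_of_lt_of_le ?_ (marg_anti h0 (subset_univ S) x)
  rw [marg_univ]
  exact (h0 x).lt_of_ne' hx

theorem marg_update_of_notMem (h : (V → ZMod 2) → ℝ) {S : Finset V} {t : V} (ht : t ∉ S)
    (x : V → ZMod 2) (s : ZMod 2) : marg h S (update x t s) = marg h S x :=
  marg_congr h fun _ hv => update_of_ne (ne_of_mem_of_not_mem hv ht) _ _

theorem sum_zmod_two {M : Type*} [AddCommMonoid M] (u : ZMod 2 → M) : ∑ s, u s = u 0 + u 1 :=
  Fin.sum_univ_two u

theorem zmod_two_cases (s : ZMod 2) : s = 0 ∨ s = 1 := by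
  revert s; decide

theorem zmod_two_eq_add_one {a b : ZMod 2} (hab : a ≠ b) : a = b + 1 := by
  revert a b; decide

theorem marg_eq_sum_insert (h : (V → ZMod 2) → ℝ) {S : Finset V} {t : V} (ht : t ∉ S)
    (x : V → ZMod 2) : marg h S x = ∑ s, marg h (insert t S) (update x t s) := by
  unfold marg
  rw [← sum_fiberwise _ (fun z : V → ZMod 2 => z t)]
  refine sum_congr rfl fun s _ => ?_
  rw [filter_filter]
  congr 1
  ext z
  simp only [mem_filter, mem_univ, true_and, mem_insert, forall_eq_or_imp, update_self]
  rw [and_comm]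
  refine and_congr_right fun _ => forall₂_congr fun v hv => ?_
  rw [update_of_ne (ne_of_mem_of_not_mem hv ht)]

theorem marg_eq_add (h : (V → ZMod 2) → ℝ) {S : Finset V} {t : V} (ht : t ∉ S)
    (x : V → ZMod 2) : marg h S x =
      marg h (insert t S) (update x t 0) + marg h (insert t S) (update x t 1) := by
  rw [marg_eq_sum_insert h ht, sum_zmod_two]

/-- A property preserved by changing single coordinates holds everywhere if it holds somewhere. -/
theorem forall_of_update {P : (V → ZMod 2) → Prop} (hP : ∀ x t s, P x → P (update x t s))
    {x : V → ZMod 2} (hx : P x) (y : V → ZMod 2) : P y := by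
  have key : ∀ S : Finset V, P (S.piecewise y x) := by
    intro S
    induction S using Finset.induction_on with
    | empty => simpa using hx
    | insert t S _ ih =>
      rw [piecewise_insert]
      exact hP _ _ _ ih
  simpa using key univ

/-- A coordinate that is not determined by the others is independent of them. -/
theorem MargBlockRankOne.independent {h : (V → ZMod 2) → ℝ} (h0 : ∀ x, 0 ≤ h x)
    (hh : MargBlockRankOne h) {S : Finset V} {t : V} (ht : t ∉ S) (hdet : ¬ Determined h S t) :
    ∃ u : ZMod 2 → ℝ, (∀ s, 0 < u s) ∧
      ∀ x, marg h (insert t S) x = marg h S x * u (x t) := by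
  unfold Determined at hdet
  push Not at hdet
  obtain ⟨x, hx⟩ := hdet
  set a : ZMod 2 → ℝ := fun s => marg h (insert t S) (update x t s) with ha
  have hpos : ∀ s, 0 < a s := by
    intro s
    refine lt_of_le_of_ne (marg_nonneg h0 _ _) fun e => hx ?_
    rcases zmod_two_cases s with rfl | rfl
    · simp [← show (0 : ℝ) = marg h (insert t S) (update x t 0) from e]
    · simp [← show (0 : ℝ) = marg h (insert t S) (update x t 1) from e]
  have h01 : 0 < a 0 + a 1 := add_pos (hpos 0) (hpos 1)
  refine ⟨fun s => a s / (a 0 + a 1), fun s => div_pos (hpos s) h01, fun y => ?_⟩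
  have hy : marg h (insert t S) y = marg h (insert t S) (update y t (y t)) := by
    rw [update_eq_self]
  rw [marg_eq_add h ht y, hy]
  set b : ZMod 2 → ℝ := fun s => marg h (insert t S) (update y t s) with hb
  change b (y t) = (b 0 + b 1) * (a (y t) / (a 0 + a 1))
  -- Row `x` is positive in both columns, so a row orthogonal to it vanishes and is trivially
  -- proportional to it.
  have hab : a 0 * b 1 = a 1 * b 0 := by
    rcases hh S t ht x y with e | e
    · exact e
    · have e' : ∀ s, b s = 0 := fun s => (mul_eq_zero.1 (e s)).resolve_left (hpos s).ne'
      rw [e' 0, e' 1, mul_zero, mul_zero]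
  rw [← mul_div_assoc, eq_div_iff h01.ne']
  rcases zmod_two_cases (y t) with e | e <;> rw [e] <;> linarith

/-- Independence passes to subsets of the conditioning coordinates. -/
theorem marg_insert_empty_of_independent (h : (V → ZMod 2) → ℝ) {t : V} (u : ZMod 2 → ℝ)
    (S : Finset V) (ht : t ∉ S)
    (hu : ∀ x, marg h (insert t S) x = marg h S x * u (x t)) (x : V → ZMod 2) :
    marg h {t} x = marg h ∅ x * u (x t) := by
  induction S using Finset.induction_on with
  | empty => simpa using hu x
  | insert d S hd ih =>
    have htd : t ≠ d := fun e => ht (e ▸ mem_insert_self _ _)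
    have htS : t ∉ S := fun e => ht (mem_insert_of_mem e)
    refine ih htS fun y => ?_
    have hd' : d ∉ insert t S := by simp [hd, htd.symm]
    -- The factor `u (x t)` does not involve `d`, so it survives summing `d` out.
    rw [marg_eq_sum_insert h hd', marg_eq_sum_insert h hd, sum_mul]
    refine sum_congr rfl fun s _ => ?_
    rw [Finset.insert_comm, hu, update_of_ne htd]

/-- On the support, `t` is a sum of at least two free coordinates, up to a constant. -/
def IsCircuit (h : (V → ZMod 2) → ℝ) (D : Finset V) (t : V) (c : ZMod 2) : Prop :=
  t ∉ D ∧ 2 ≤ #D ∧ (∀ x, 0 < marg h D x) ∧ ∀ x, h x ≠ 0 → x t = c + ∑ d ∈ D, x d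

/-- By minimality `t` is independent of `D.erase d` for each `d ∈ D`, yet determined by `D`. Hence
flipping any single `d` stays in the support and must flip `t`. Flips connect all assignments, which
yields both full support on `D` and the parity. -/
theorem Determined.exists_parity {h : (V → ZMod 2) → ℝ} (h0 : ∀ x, 0 ≤ h x)
    (hh : MargBlockRankOne h) (hne : ∃ x, h x ≠ 0) {D : Finset V} {t : V} (ht : t ∉ D)
    (hdet : Determined h D t) (hmin : ∀ d ∈ D, ¬ Determined h (D.erase d) t) :
    (∀ x, 0 < marg h D x) ∧
      ∃ c, ∀ x, marg h (insert t D) x ≠ 0 → x t = c + ∑ d ∈ D, x d := by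
  have huniq : ∀ x s s', marg h (insert t D) (update x t s) ≠ 0 →
      marg h (insert t D) (update x t s') ≠ 0 → s = s' := by
    intro x s s' hs hs'
    have := hdet x
    rcases zmod_two_cases s with rfl | rfl <;> rcases zmod_two_cases s' with rfl | rfl
    · rfl
    · exact absurd this (mul_ne_zero hs hs')
    · exact absurd this (mul_ne_zero hs' hs)
    · rfl
  -- With `d` released, both values of `t` become possible.
  have hsplit : ∀ {x d}, d ∈ D → marg h D x ≠ 0 → ∀ s, ∃ a,
      marg h (insert t D) (update (update x d a) t s) ≠ 0 := by
    intro x d hd hx s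
    have htd : t ≠ d := fun e => ht (e ▸ hd)
    have htD : t ∉ D.erase d := fun e => ht (mem_of_mem_erase e)
    obtain ⟨u, hu, hu'⟩ := hh.independent h0 htD (hmin d hd)
    have h1 : 0 < marg h (D.erase d) x :=
      ((marg_nonneg h0 _ _).lt_of_ne' hx).trans_le (marg_anti h0 (erase_subset _ _) x)
    have h2 : marg h (insert t (D.erase d)) (update x t s) ≠ 0 := by
      rw [hu', marg_update_of_notMem h htD, update_self]
      exact (mul_pos h1 (hu s)).ne'
    have hd' : d ∉ insert t (D.erase d) := by simp [htd.symm]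
    rw [marg_eq_sum_insert h hd'] at h2
    obtain ⟨a, -, ha⟩ := exists_ne_zero_of_sum_ne_zero h2
    rw [Finset.insert_comm, insert_erase hd, update_comm htd] at ha
    exact ⟨a, ha⟩
  have hle : ∀ x s, marg h (insert t D) (update x t s) ≠ 0 → marg h D x ≠ 0 := by
    intro x s hs
    have := ((marg_nonneg h0 _ _).lt_of_ne' hs).trans_le (marg_anti h0 (subset_insert t D) _)
    rw [marg_update_of_notMem h ht] at this
    exact this.ne'
  -- flipping a coordinate of `D` keeps the support and flips the value of `t`
  have hflip : ∀ x d s, d ∈ D → marg h (insert t D) (update x t s) ≠ 0 →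
      marg h (insert t D) (update (update x d (x d + 1)) t (s + 1)) ≠ 0 := by
    intro x d s hd hs
    obtain ⟨a, ha⟩ := hsplit hd (hle x s hs) (s + 1)
    have hax : a ≠ x d := by
      rintro rfl
      rw [update_eq_self] at ha
      have := huniq x _ _ hs ha
      simp at this
    rwa [zmod_two_eq_add_one hax] at ha
  obtain ⟨x₀, hx₀⟩ := hne
  -- Chosen so that the parity holds at the support point `x₀`, in characteristic 2.
  set c : ZMod 2 := x₀ t + ∑ d ∈ D, x₀ d with hc
  have key : ∀ x, marg h (insert t D) (update x t (c + ∑ d ∈ D, x d)) ≠ 0 := by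
    refine forall_of_update (x := x₀) (fun x d s hx => ?_) ?_
    · by_cases hs : s = x d
      · rwa [hs, update_eq_self]
      · rw [zmod_two_eq_add_one hs]
        by_cases hd : d ∈ D
        · have := hflip x d _ hd hx
          rw [sum_update_of_mem hd]
          convert this using 3
          rw [← add_sum_erase D x hd, sdiff_singleton_eq_erase]
          ring
        · rw [sum_update_of_notMem hd]
          by_cases hdt : d = t
          · subst hdt
            rwa [update_idem]
          · rwa [update_comm hdt, marg_update_of_notMem h (by simp [hd, hdt])]
    · have : c + ∑ d ∈ D, x₀ d = x₀ t := by
        rw [hc, add_assoc, CharTwo.add_self_eq_zero, add_zero]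
      rw [this, update_eq_self]
      exact (marg_pos h0 hx₀ _).ne'
  refine ⟨fun x => (marg_nonneg h0 _ _).lt_of_ne' (hle x _ (key x)), c, fun x hx => ?_⟩
  exact huniq x _ _ (by rwa [update_eq_self]) (key x)

/-- Each further coordinate is independent of the previous ones, or a parity of some of them. -/
theorem MargBlockRankOne.marg_insert {h : (V → ZMod 2) → ℝ} (h0 : ∀ x, 0 ≤ h x)
    (hh : MargBlockRankOne h) (hne : ∃ x, h x ≠ 0) {S : Finset V} {t : V} (ht : t ∉ S) :
    (∃ u : ZMod 2 → ℝ, (∀ s, 0 < u s) ∧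
        ∀ x, marg h (insert t S) x = marg h S x * u (x t)) ∨
      ∃ D ⊆ S, ∃ c, (2 ≤ #D → IsCircuit h D t c) ∧
        ∀ x, marg h (insert t S) x = marg h S x * if x t = c + ∑ d ∈ D, x d then 1 else 0 := by
  by_cases hdet : Determined h S t
  · right
    obtain ⟨D, hDS, hD⟩ :=
      exists_minimal_le_of_wellFoundedLT (fun D => D ⊆ S ∧ Determined h D t) S ⟨Subset.rfl, hdet⟩
    have htD : t ∉ D := fun e => ht (hDS e)
    obtain ⟨hpos, c, hc⟩ := hD.prop.2.exists_parity h0 hh hne htD fun d hd hd' =>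
      notMem_erase d D (hD.le_of_le ⟨(erase_subset _ _).trans hDS, hd'⟩ (erase_subset _ _) hd)
    refine ⟨D, hDS, c, fun h2 => ⟨htD, h2, hpos, fun x hx => hc x ?_⟩, fun x => ?_⟩
    · exact (marg_pos h0 hx _).ne'
    · have hz : ∀ s, s ≠ c + ∑ d ∈ D, x d → marg h (insert t S) (update x t s) = 0 := by
        intro s hs
        by_contra hne
        have h1 := ((marg_nonneg h0 _ _).lt_of_ne' hne).trans_le
          (marg_anti h0 (insert_subset_insert t hDS) _)
        have h2 := hc _ h1.ne'
        rw [update_self, sum_update_of_notMem htD] at h2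
        exact hs h2
      rw [marg_eq_sum_insert h ht x, sum_eq_single (c + ∑ d ∈ D, x d) (fun s _ hs => hz s hs)
        (by simp)]
      split_ifs with e
      · rw [← e, update_eq_self, mul_one]
      · rw [mul_zero, ← hz _ e, update_eq_self]
  · exact Or.inl (hh.independent h0 ht hdet)

end Marginals

/-! ### From the condition on numbered instances to marginals over any finite index type -/

section Instances

variable {V : Type*} [Fintype V] [DecidableEq V]

/-- The real part of a function; it carries all information if the function is non-negative. -/
def BoolFn.re (f : BoolFn) (x : Fin f.arity → ZMod 2) : ℝ := (f.val x).re

theorem BoolFn.NonNeg.val_eq {f : BoolFn} (hf : f.NonNeg) (x : Fin f.arity → ZMod 2) :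
    f.val x = (f.re x : ℂ) := by
  obtain ⟨-, r, -, hr⟩ := hf x
  rw [BoolFn.re, hr, Complex.ofReal_re]

theorem BoolFn.NonNeg.re_nonneg {f : BoolFn} (hf : f.NonNeg) (x : Fin f.arity → ZMod 2) :
    0 ≤ f.re x := by
  obtain ⟨-, r, h0, hr⟩ := hf x
  rwa [BoolFn.re, hr, Complex.ofReal_re]

/-- A finite type can be numbered so that a given subset comes first, followed by a given point. -/
theorem exists_numbering (S : Finset V) {t : V} (ht : t ∉ S) :
    ∃ e : V ≃ Fin (Fintype.card V), (∀ v, v ∈ S ↔ (e v : ℕ) < #S) ∧ (e t : ℕ) = #S := by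
  classical
  have hlt : #S < Fintype.card V := by
    rw [← Finset.card_univ]
    exact card_lt_card ⟨subset_univ _, fun h => ht (h (mem_univ t))⟩
  let e₀ := Fintype.equivFin V
  have hcard : Fintype.card {i // e₀.symm i ∈ S} =
      Fintype.card {i : Fin (Fintype.card V) // (i : ℕ) < #S} := by
    rw [Fintype.card_congr (e₀.symm.subtypeEquiv (q := fun v => v ∈ S) fun _ => Iff.rfl),
      Fintype.card_coe, Fintype.card_subtype]
    have : univ.filter (fun i : Fin (Fintype.card V) => (i : ℕ) < #S) = Iio ⟨#S, hlt⟩ := by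
      ext i
      simp [Fin.lt_def]
    rw [this, Fin.card_Iio]
  let σ := (Fintype.equivOfCardEq hcard).extendSubtype
  have hσ : ∀ v, v ∈ S ↔ (σ (e₀ v) : ℕ) < #S := fun v =>
    ⟨fun h => (Fintype.equivOfCardEq hcard).extendSubtype_mem _ (by simpa using h),
      fun h => by
        by_contra h'
        exact (Fintype.equivOfCardEq hcard).extendSubtype_not_mem (e₀ v) (by simpa using h') h⟩
  -- Both swapped positions lie outside the initial block, so `S` keeps its place.
  refine ⟨(e₀.trans σ).trans (Equiv.swap (σ (e₀ t)) ⟨#S, hlt⟩), fun v => ?_, by simp⟩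
  rw [hσ]
  have htσ : ¬ (σ (e₀ t) : ℕ) < #S := fun h => ht ((hσ t).2 h)
  simp only [Equiv.trans_apply, Equiv.swap_apply_def]
  split_ifs with h1 h2
  · rw [h1]
    simpa using htσ
  · rw [h2]
    simpa using htσ
  · rfl

theorem cross_eq_of_not_linearIndependent {α : Type*} {p q : α → ℂ}
    (hpq : ¬ LinearIndependent ℂ ![p, q]) (a b : α) : p a * q b = p b * q a := by
  rw [LinearIndependent.pair_iff] at hpq
  push Not at hpq
  obtain ⟨s, t, hst, hne⟩ := hpq
  have ea : s * p a + t * q a = 0 := congrFun hst a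
  have eb : s * p b + t * q b = 0 := congrFun hst b
  by_cases hs : s = 0
  · apply mul_left_cancel₀ (hne hs)
    linear_combination p a * eb - p b * ea
  · apply mul_left_cancel₀ hs
    linear_combination q b * ea - q a * eb

/-- The Block-rank-one condition for an instance with arbitrary finite index types. -/
theorem BlockRankOneCondition.margBlockRankOne {F : Set BoolFn} (hF : ∀ f ∈ F, f.NonNeg)
    (hblock : BlockRankOneCondition F) {C : Type*} [Fintype C] (fn : C → BoolFn)
    (hfn : ∀ c, fn c ∈ F) (scope : ∀ c, Fin (fn c).arity → V)
    (htwice : ∀ v, ∑ c, #{k | scope c k = v} = 2) :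
    MargBlockRankOne (fun x : V → ZMod 2 => ∏ c, (fn c).re fun k => x (scope c k)) := by
  classical
  set h : (V → ZMod 2) → ℝ := fun x => ∏ c, (fn c).re fun k => x (scope c k) with hh
  have h0 : ∀ x, 0 ≤ h x := fun x => prod_nonneg fun c _ => (hF _ (hfn c)).re_nonneg _
  intro S t ht x y
  -- `sumOut` keeps an initial segment of the variables, and the last one kept is the column index:
  -- this must be `t`.
  obtain ⟨e, heS, het⟩ := exists_numbering S ht
  let eC := Fintype.equivFin C
  let I : Instance F :=
    { numVars := Fintype.card V
      numCons := Fintype.card C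
      fn := fun c => fn (eC.symm c)
      fn_mem := fun c => hfn _
      scope := fun c k => e (scope _ k)
      read_twice := fun v => by
        rw [← htwice (e.symm v), Fintype.card_subtype, ← eC.symm.sum_comp, card_filter,
          Fintype.sum_sigma]
        refine sum_congr rfl fun c _ => ?_
        rw [card_filter]
        refine sum_congr rfl fun k _ => ?_
        simp only [Equiv.eq_symm_apply] }
  have hI : ∀ z : V → ZMod 2, I.toFn (fun i => z (e.symm i)) = (h z : ℂ) := by
    intro z
    simp only [Instance.toFn, hh, Complex.ofReal_prod, I, Equiv.symm_apply_apply]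
    rw [← eC.symm.prod_comp]
    exact prod_congr rfl fun c _ => (hF _ (hfn _)).val_eq _
  have hk : #S + 1 ≤ I.numVars := by
    have := (e t).2
    rw [het] at this
    exact this
  have hsum : ∀ (z : V → ZMod 2) (s : ZMod 2),
      sigMatrix (sumOut I.toFn (#S + 1) hk) (#S + 1 - 1)
        (fun i => z (e.symm (Fin.castLE (by omega) i))) (fun _ => s) =
        (marg h (insert t S) (update z t s) : ℂ) := by
    intro z s
    simp only [sigMatrix, sumOut, marg, Complex.ofReal_sum]
    symm
    refine sum_nbij' (fun w i => w (e.symm i)) (fun w v => w (e v)) ?_ ?_ ?_ ?_ ?_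
    · intro w hw
      simp only [mem_filter, mem_univ, true_and, mem_insert, forall_eq_or_imp, update_self] at hw ⊢
      intro i
      split_ifs with hi
      · have hmem : e.symm (Fin.castLE hk i) ∈ S := by
          rw [heS, Equiv.apply_symm_apply]
          exact hi
        rw [hw.2 _ hmem, update_of_ne (ne_of_mem_of_not_mem hmem ht)]
        rfl
      · rw [← hw.1]
        congr 1
        rw [Equiv.symm_apply_eq]
        ext
        rw [het]
        have := i.2
        simp only [Fin.val_castLE]
        omega
    · intro w hw
      simp only [mem_filter, mem_univ, true_and, mem_insert, forall_eq_or_imp, update_self] at hw ⊢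
      constructor
      · have := hw ⟨#S, by omega⟩
        simp only [Nat.add_sub_cancel, lt_irrefl, dite_false] at this
        rw [← this]
        congr 1
        ext
        rw [het]
        rfl
      · intro v hv
        have hlt := (heS v).1 hv
        have := hw ⟨e v, by omega⟩
        simp only [Nat.add_sub_cancel, hlt, dite_true] at this
        rw [update_of_ne (ne_of_mem_of_not_mem hv ht)]
        convert this using 2
        · rfl
        · exact (e.symm_apply_apply v).symm
    · intro w _
      simp
    · intro w _
      simp
    · intro w _
      exact (hI w).symm
  rcases hblock ⟨_, _⟩ ⟨I, _, hk, by omega, rfl⟩ with h1 | h1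
  -- In the unary case the marginal depends on `t` alone, so the two rows coincide.
  · have hS : S = ∅ := by
      have : #S + 1 = 1 := h1
      rw [← card_eq_zero]
      omega
    left
    subst hS
    rw [mul_comm]
    congr 1 <;> exact marg_congr h fun v hv => by
      rw [mem_insert] at hv
      simp only [notMem_empty, or_false] at hv
      simp [hv]
  · have hk' : #S + 1 - 1 ≤ Fintype.card V := (Nat.sub_le _ _).trans hk
    rcases h1 (fun i => x (e.symm (Fin.castLE hk' i)))
      (fun i => y (e.symm (Fin.castLE hk' i))) with h2 | h2
    · left
      have := cross_eq_of_not_linearIndependent h2 (fun _ => 0) (fun _ => 1)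
      rw [hsum, hsum, hsum, hsum] at this
      exact_mod_cast this
    · right
      have hconst : ∀ c : Fin (#S + 1 - (#S + 1 - 1)) → ZMod 2,
          c = fun _ => c ⟨0, by omega⟩ := fun c => by
        ext i
        congr 2
        ext
        have := i.2
        simp only
        omega
      have hterm : ∀ c : Fin (#S + 1 - (#S + 1 - 1)) → ZMod 2, ∀ z : V → ZMod 2,
          sigMatrix (sumOut I.toFn (#S + 1) hk) (#S + 1 - 1)
            (fun i => z (e.symm (Fin.castLE (by omega) i))) c =
          (marg h (insert t S) (update z t (c ⟨0, by omega⟩)) : ℂ) := fun c z => by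
        rw [hconst c]
        exact hsum z _
      simp only [dotProduct, hterm] at h2
      have h3 : ∑ c : Fin (#S + 1 - (#S + 1 - 1)) → ZMod 2,
          marg h (insert t S) (update x t (c ⟨0, by omega⟩)) *
            marg h (insert t S) (update y t (c ⟨0, by omega⟩)) = 0 := by
        exact_mod_cast h2
      -- Non-negativity turns orthogonality into the vanishing of every term.
      rw [sum_eq_zero_iff_of_nonneg fun _ _ =>
        mul_nonneg (marg_nonneg h0 _ _) (marg_nonneg h0 _ _)] at h3
      exact fun s => h3 (fun _ => s) (mem_univ _)

end Instances

/-! ### The crossover gadget -/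

section Gadgets

variable {V W : Type*} [DecidableEq V] [Fintype W] [DecidableEq W]

/-- Two copies of `p` and two copies of `q`, with the variable `b` of one copy of `p` exchanged for
the variable `t` of one copy of `q`. -/
def crossover (p : (V → ZMod 2) → ℝ) (q : (W → ZMod 2) → ℝ) (b : V) (t : W)
    (z : V ⊕ W → ZMod 2) : ℝ :=
  p (fun v => z (.inl v)) * p (fun v => z (if v = b then .inr t else .inl v)) *
    (q (fun w => z (.inr w)) * q (fun w => z (if w = t then .inl b else .inr w)))

/-- On the support of `q`, the first copy makes `y t` the parity of `D`, and the second copy makes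
`x b` the same parity. The exchanged variables then agree, so the exchange has no further effect. -/
theorem crossover_eq {p : (V → ZMod 2) → ℝ} {q : (W → ZMod 2) → ℝ} (b : V) {D : Finset W} {t : W}
    {c : ZMod 2} (hD : IsCircuit (fun y => q y * q y) D t c) (x : V → ZMod 2) (y : W → ZMod 2) :
    crossover p q b t (Sum.elim x y) =
      if x b = c + ∑ d ∈ D, y d then p x * p x * (q y * q y) else 0 := by
  obtain ⟨htD, -, -, hsupp⟩ := hD
  simp only [crossover, Sum.elim_inl, Sum.elim_inr]
  by_cases hq : q y = 0
  · simp [hq]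
  have hy : y t = c + ∑ d ∈ D, y d := hsupp y (mul_ne_zero hq hq)
  have hq' : (fun w => (Sum.elim x y (if w = t then .inl b else .inr w) : ZMod 2)) =
      update y t (x b) := by
    ext w
    by_cases hw : w = t
    · subst hw; simp
    · simp [hw]
  have hp' : (fun v => (Sum.elim x y (if v = b then .inr t else .inl v) : ZMod 2)) =
      update x b (y t) := by
    ext v
    by_cases hv : v = b
    · subst hv; simp
    · simp [hv]
  rw [hq', hp']
  split_ifs with h
  · rw [← hy] at h
    rw [h, update_eq_self, ← h, update_eq_self]
  · have : q (update y t (x b)) = 0 := by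
      by_contra hne
      have := hsupp _ (mul_ne_zero hne hne)
      rw [update_self, sum_update_of_notMem htD] at this
      exact h this
    rw [this, mul_zero, mul_zero]

variable [Fintype V]

theorem marg_single (h : (V → ZMod 2) → ℝ) (b : V) (s : ZMod 2) :
    marg h {b} (fun _ => s) = ∑ x, if x b = s then h x else 0 := by
  rw [marg, sum_filter]
  simp

theorem marg_crossover {p : (V → ZMod 2) → ℝ} {q : (W → ZMod 2) → ℝ} (b : V) {D : Finset W} {t : W}
    {c : ZMod 2} (hD : IsCircuit (fun y => q y * q y) D t c) (x : V → ZMod 2) (y : W → ZMod 2) :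
    marg (crossover p q b t) (D.map .inr) (Sum.elim x y) =
      marg (fun x => p x * p x) {b} (fun _ => c + ∑ d ∈ D, y d) *
        marg (fun y => q y * q y) D y := by
  rw [marg_single, marg, marg, sum_filter, sum_filter,
    ← (Equiv.sumArrowEquivProdArrow V W (ZMod 2)).symm.sum_comp, Fintype.sum_prod_type, sum_mul]
  refine sum_congr rfl fun x' _ => ?_
  rw [mul_sum]
  refine sum_congr rfl fun y' _ => ?_
  have hxy : (Equiv.sumArrowEquivProdArrow V W (ZMod 2)).symm (x', y') = Sum.elim x' y' := rfl
  rw [hxy, crossover_eq b hD]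
  simp only [mem_map, Embedding.inr_apply, forall_exists_index, and_imp, forall_apply_eq_imp_iff₂,
    Sum.elim_inr]
  by_cases hy : ∀ d ∈ D, y' d = y d
  · rw [if_pos hy, if_pos hy, sum_congr rfl hy]
    split_ifs <;> simp
  · rw [if_neg hy, if_neg hy, mul_zero]

/-- A skewed variable cannot coexist with a circuit. -/
theorem not_margBlockRankOne_crossover {p : (V → ZMod 2) → ℝ} {q : (W → ZMod 2) → ℝ} {b : V}
    {D : Finset W} {t : W} {c : ZMod 2} (hb : IsSkewed (fun x => p x * p x) b)
    (hD : IsCircuit (fun y => q y * q y) D t c)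
    (hq : MargBlockRankOne fun y => q y * q y) : ¬ MargBlockRankOne (crossover p q b t) := by
  intro hG
  set P : ZMod 2 → ℝ := fun s => marg (fun x => p x * p x) {b} (fun _ => s) with hP
  obtain ⟨h0, h1, h01⟩ := hb
  have hP0 : ∀ s, 0 ≤ P s := fun s => marg_nonneg (fun _ => mul_self_nonneg _) _ _
  have hPpos : ∀ s, 0 < P s := fun s => (hP0 s).lt_of_ne' <| by
    rcases zmod_two_cases s with rfl | rfl
    exacts [h0, h1]
  have hmarg := marg_crossover (p := p) b hD
  obtain ⟨-, hcard, hpos, -⟩ := hD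
  obtain ⟨d, hd, e, he, hde⟩ := one_lt_card.1 hcard
  set y₀ : W → ZMod 2 := fun _ => 0 with hy₀
  -- Changing `e` reverses the parity for each value of `d`. The diagonal of the minor therefore
  -- carries `P c` twice and the antidiagonal `P (c + 1)` twice.
  set y₁ : W → ZMod 2 := update y₀ e 1 with hy₁
  have hins : insert (Sum.inr d) ((D.erase d).map (.inr : W ↪ V ⊕ W)) = D.map .inr := by
    rw [← Embedding.inr_apply, ← map_insert, insert_erase hd]
  have hs₀ : ∀ s, ∑ i ∈ D, update y₀ d s i = s := fun s => by
    rw [sum_update_of_mem hd, sum_eq_zero fun _ _ => rfl, add_zero]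
  have hs₁ : ∀ s, ∑ i ∈ D, update y₁ d s i = s + 1 := fun s => by
    rw [sum_update_of_mem hd, hy₁, sum_update_of_mem (by simp [he, hde.symm]),
      sum_eq_zero fun _ _ => rfl, add_zero]
  have hQ := hq (D.erase d) d (notMem_erase d D) y₀ y₁
  rw [insert_erase hd] at hQ
  have hG' := hG ((D.erase d).map .inr) (.inr d) (by simp) (Sum.elim (fun _ => 0) y₀)
    (Sum.elim (fun _ => 0) y₁)
  simp only [hins, Sum.update_elim_inr, hmarg, hs₀, hs₁] at hG'
  set Q : (W → ZMod 2) → ℝ := marg (fun y => q y * q y) D with hQdef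
  -- Full support on `D` excludes orthogonality, so the minor of `Q` vanishes and cancels from that
  -- of the gadget.
  have hQ' := hQ.resolve_right fun h => (mul_pos (hpos _) (hpos _)).ne' (h 0)
  have hG'' := hG'.resolve_right fun h =>
    (mul_pos (mul_pos (hPpos _) (hpos _)) (mul_pos (hPpos _) (hpos _))).ne' (h 0)
  have h11 : (1 : ZMod 2) + 1 = 0 := rfl
  rw [zero_add, add_zero, h11, add_zero] at hG''
  change P c * Q _ * (P c * Q _) = P (c + 1) * Q _ * (P (c + 1) * Q _) at hG''
  have hsq : P c * P c = P (c + 1) * P (c + 1) := by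
    apply mul_right_cancel₀ (mul_pos (hpos (update y₀ d 0)) (hpos (update y₁ d 1))).ne'
    change P c * P c * (Q _ * Q _) = P (c + 1) * P (c + 1) * (Q _ * Q _)
    calc _ = P c * Q (update y₀ d 0) * (P c * Q (update y₁ d 1)) := by ring
      _ = _ := hG''
      _ = P (c + 1) * P (c + 1) * (Q (update y₀ d 1) * Q (update y₁ d 0)) := by ring
      _ = _ := by rw [← hQ']
  have heq : P c = P (c + 1) := (mul_self_inj (hP0 _) (hP0 _)).1 hsq
  rcases zmod_two_cases c with rfl | rfl
  · rw [zero_add] at heq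
    exact h01 heq
  · rw [h11] at heq
    exact h01 heq.symm

theorem BlockRankOneCondition.sq {F : Set BoolFn} (hF : ∀ f ∈ F, f.NonNeg)
    (hblock : BlockRankOneCondition F) {f : BoolFn} (hf : f ∈ F) :
    MargBlockRankOne fun x => f.re x * f.re x := by
  have := hblock.margBlockRankOne hF (V := Fin f.arity) (C := Bool) (fun _ => f) (fun _ => hf)
    (fun _ k => k) (fun v => by simp [filter_eq'])
  simpa only [Fintype.prod_bool] using this

theorem BlockRankOneCondition.crossover {F : Set BoolFn} (hF : ∀ f ∈ F, f.NonNeg)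
    (hblock : BlockRankOneCondition F) {f g : BoolFn} (hf : f ∈ F) (hg : g ∈ F)
    (b : Fin f.arity) (t : Fin g.arity) : MargBlockRankOne (crossover f.re g.re b t) := by
  let fn : Bool × Bool → BoolFn := fun
    | (true, _) => f
    | (false, _) => g
  let scope : ∀ c, Fin (fn c).arity → Fin f.arity ⊕ Fin g.arity := fun
    | (true, true) => fun k => .inl k
    | (true, false) => fun k => if k = b then .inr t else .inl k
    | (false, true) => fun k => .inr k
    | (false, false) => fun k => if k = t then .inl b else .inr k
  have := hblock.margBlockRankOne hF fn (by rintro ⟨_ | _, _⟩ <;> assumption) scope ?_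
  · simp only [Fintype.prod_prod_type, Fintype.prod_bool] at this
    exact this
  · intro v
    rw [Fintype.sum_prod_type, Fintype.sum_bool, Fintype.sum_bool, Fintype.sum_bool]
    change #{k : Fin f.arity | (Sum.inl k : Fin f.arity ⊕ Fin g.arity) = v} +
      #{k : Fin f.arity | (if k = b then .inr t else .inl k : Fin f.arity ⊕ Fin g.arity) = v} +
      (#{k : Fin g.arity | (Sum.inr k : Fin f.arity ⊕ Fin g.arity) = v} +
      #{k : Fin g.arity | (if k = t then .inl b else .inr k : Fin f.arity ⊕ Fin g.arity) = v}) = 2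
    rcases v with i | j
    · by_cases hi : i = b
      · subst hi
        have h1 : ∀ k, ((if k = i then .inr t else .inl k : Fin f.arity ⊕ Fin g.arity) =
            .inl i) ↔ False := fun k => by split_ifs with h <;> simp [h]
        have h2 : ∀ k, ((if k = t then .inl i else .inr k : Fin f.arity ⊕ Fin g.arity) =
            .inl i) ↔ k = t := fun k => by split_ifs with h <;> simp [h]
        simp [h1, h2, filter_eq']
      · have h1 : ∀ k, ((if k = b then .inr t else .inl k : Fin f.arity ⊕ Fin g.arity) =
            .inl i) ↔ k = i := fun k => by
          split_ifs with h
          · simp [h, Ne.symm hi]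
          · simp
        have h2 : ∀ k, ((if k = t then .inl b else .inr k : Fin f.arity ⊕ Fin g.arity) =
            .inl i) ↔ False := fun k => by split_ifs with h <;> simp [Ne.symm hi]
        simp [h1, h2, filter_eq']
    · by_cases hj : j = t
      · subst hj
        have h1 : ∀ k, ((if k = b then .inr j else .inl k : Fin f.arity ⊕ Fin g.arity) =
            .inr j) ↔ k = b := fun k => by split_ifs with h <;> simp [h]
        have h2 : ∀ k, ((if k = j then .inl b else .inr k : Fin f.arity ⊕ Fin g.arity) =
            .inr j) ↔ False := fun k => by split_ifs with h <;> simp [h]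
        simp [h1, h2, filter_eq']
      · have h1 : ∀ k, ((if k = b then .inr t else .inl k : Fin f.arity ⊕ Fin g.arity) =
            .inr j) ↔ False := fun k => by split_ifs with h <;> simp [Ne.symm hj]
        have h2 : ∀ k, ((if k = t then .inl b else .inr k : Fin f.arity ⊕ Fin g.arity) =
            .inr j) ↔ k = j := fun k => by
          split_ifs with h
          · simp [h, Ne.symm hj]
          · simp
        simp [h1, h2, filter_eq']

end Gadgets

/-! ### Membership in the affine and product-type classes -/

section Classes

variable {n : ℕ}

theorem isAffineRel_univ : IsAffineRel (Set.univ : Set (Fin n → ZMod 2)) :=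
  ⟨0, 0, 0, by ext x; simp⟩

theorem isAffineRel_empty : IsAffineRel (∅ : Set (Fin n → ZMod 2)) :=
  ⟨1, 0, 1, by ext x; simp⟩

theorem IsAffineRel.inter_hyperplane {S : Set (Fin n → ZMod 2)} (hS : IsAffineRel S)
    (a : Fin n → ZMod 2) (b : ZMod 2) : IsAffineRel (S ∩ {x | a ⬝ᵥ x = b}) := by
  obtain ⟨m, A, B, rfl⟩ := hS
  refine ⟨m + 1, Matrix.of (Matrix.vecCons a A), Matrix.vecCons b B, ?_⟩
  ext x
  simp only [Set.mem_inter_iff, Set.mem_ofPred_eq, funext_iff, Fin.forall_fin_succ,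
    Matrix.mulVec, Matrix.of_apply, Matrix.cons_val_zero, Matrix.cons_val_succ]
  exact and_comm

theorem IsAffineRel.inter_parity {S : Set (Fin n → ZMod 2)} (hS : IsAffineRel S)
    {D : Finset (Fin n)} {t : Fin n} (ht : t ∉ D) (c : ZMod 2) :
    IsAffineRel (S ∩ {x | x t = c + ∑ d ∈ D, x d}) := by
  -- In characteristic 2 the parity constraint reads `x t + ∑ d ∈ D, x d = c`.
  convert hS.inter_hyperplane (fun i => if i ∈ insert t D then 1 else 0) c using 2
  ext x
  simp only [Set.mem_ofPred_eq, dotProduct, ite_mul, one_mul, zero_mul, sum_ite_mem, univ_inter]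
  rw [sum_insert ht]
  generalize x t = u
  generalize ∑ d ∈ D, x d = v
  revert u v c
  decide

theorem exists_marg_empty (h : (Fin n → ZMod 2) → ℝ) : ∃ κ, ∀ x, marg h ∅ x = κ :=
  ⟨marg h ∅ 0, fun _ => marg_congr h (by simp)⟩

/-- Without skewed coordinates, all marginals are constant on an affine support. -/
theorem MargBlockRankOne.isAffineRel_and_const {h : (Fin n → ZMod 2) → ℝ} (h0 : ∀ x, 0 ≤ h x)
    (hh : MargBlockRankOne h) (hne : ∃ x, h x ≠ 0)
    (hskew : ∀ b, ¬ IsSkewed h b) (S : Finset (Fin n)) :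
    IsAffineRel {x | marg h S x ≠ 0} ∧ ∃ κ, ∀ x, marg h S x ≠ 0 → marg h S x = κ := by
  induction S using Finset.induction_on with
  | empty =>
    obtain ⟨κ, hκ⟩ := exists_marg_empty h
    refine ⟨?_, κ, fun x _ => hκ x⟩
    simp only [hκ]
    by_cases hκ0 : κ = 0
    · simpa [hκ0] using isAffineRel_empty
    · simpa [hκ0] using isAffineRel_univ
  | insert t S ht ih =>
    obtain ⟨haff, κ, hκ⟩ := ih
    rcases hh.marg_insert h0 hne ht with ⟨u, hu, hmul⟩ | ⟨D, hDS, c, -, hmul⟩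
    -- Up to a positive constant `u` is the marginal of `t`, which is not skewed.
    · have hu01 : u 0 = u 1 := by
        obtain ⟨x₀, hx₀⟩ := hne
        have hS := marg_pos h0 hx₀ ∅
        have key : ∀ s, marg h {t} (fun _ => s) = marg h ∅ x₀ * u s := fun s => by
          rw [marg_insert_empty_of_independent h u S ht hmul,
            marg_congr h (S := ∅) (y := x₀) (by simp)]
        by_contra hne'
        refine hskew t ?_
        rw [IsSkewed, key, key]
        exact ⟨(mul_pos hS (hu 0)).ne', (mul_pos hS (hu 1)).ne',
          fun e => hne' (mul_left_cancel₀ hS.ne' e)⟩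
      have hconst : ∀ s, u s = u 0 := fun s => by
        rcases zmod_two_cases s with rfl | rfl
        exacts [rfl, hu01.symm]
      simp only [hmul, hconst, ne_eq, mul_eq_zero, (hu 0).ne', or_false]
      exact ⟨haff, κ * u 0, fun x hx => by rw [hκ x hx]⟩
    · constructor
      · convert haff.inter_parity (fun e => ht (hDS e)) c using 1
        ext x
        simp [hmul, and_comm]
      · refine ⟨κ, fun x hx => ?_⟩
        rw [hmul] at hx ⊢
        obtain ⟨h1, h2⟩ := mul_ne_zero_iff.1 hx
        rw [if_pos (by simpa using h2), mul_one, hκ x h1]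

theorem quadForm_zero (x : Fin n → ZMod 2) : quadForm 0 0 x = 0 := by
  simp [quadForm]

theorem isAlgebraic_marg {h : (Fin n → ZMod 2) → ℝ} (halg : ∀ x, IsAlgebraic ℚ (h x : ℂ))
    (S : Finset (Fin n)) (x : Fin n → ZMod 2) : IsAlgebraic ℚ (marg h S x : ℂ) := by
  rw [marg, Complex.ofReal_sum, ← mem_algebraicClosure_iff]
  exact sum_mem fun z _ => mem_algebraicClosure_iff.2 (halg z)

theorem isAlgebraic_sqrt {r : ℝ} (h0 : 0 ≤ r) (hr : IsAlgebraic ℚ (r : ℂ)) :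
    IsAlgebraic ℚ (√r : ℂ) := by
  refine IsAlgebraic.of_pow two_pos ?_
  rwa [← Complex.ofReal_pow, Real.sq_sqrt h0]

/-- An empty `D` pins `t`, a unary factor; a singleton gives equality or disequality according to
`c`. -/
theorem exists_factor_parity {D : Finset (Fin n)} {t : Fin n} (ht : t ∉ D) (hD : #D < 2)
    (c : ZMod 2) : ∃ φ : Factor n, ∀ x,
      Factor.eval x φ = if x t = c + ∑ d ∈ D, x d then 1 else 0 := by
  rcases (by omega : #D = 0 ∨ #D = 1) with h | h
  · rw [card_eq_zero] at h
    subst h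
    refine ⟨.unary t (fun s => if s = c then 1 else 0) fun s => ?_, fun x => ?_⟩
    · split_ifs
      exacts [isAlgebraic_one, isAlgebraic_zero]
    · simp [Factor.eval]
  · obtain ⟨d, rfl⟩ := card_eq_one.1 h
    have htd : t ≠ d := by simpa using ht
    rcases zmod_two_cases c with rfl | rfl
    · exact ⟨.eq t d htd, fun x => by simp [Factor.eval]⟩
    · refine ⟨.ne t d htd, fun x => ?_⟩
      have : ∀ u v : ZMod 2, u ≠ v ↔ u = 1 + v := by decide
      simp only [Factor.eval, sum_singleton, this]

/-- Without circuits, the square roots of all marginals are of product type. -/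
theorem MargBlockRankOne.isProductType_sqrt {h : (Fin n → ZMod 2) → ℝ} (hn : 1 ≤ n)
    (h0 : ∀ x, 0 ≤ h x) (halg : ∀ x, IsAlgebraic ℚ (h x : ℂ)) (hh : MargBlockRankOne h)
    (hne : ∃ x, h x ≠ 0) (hcirc : ∀ D t c, ¬ IsCircuit h D t c) (S : Finset (Fin n)) :
    IsProductType fun x => (√(marg h S x) : ℂ) := by
  induction S using Finset.induction_on with
  | empty =>
    refine ⟨[.unary ⟨0, hn⟩ (fun _ => (√(marg h ∅ 0) : ℂ)) fun _ =>
      isAlgebraic_sqrt (marg_nonneg h0 _ _) (isAlgebraic_marg halg _ _)], fun x => ?_⟩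
    simp [Factor.eval, marg_congr h (S := ∅) (x := x) (y := 0) (by simp)]
  | insert t S ht ih =>
    obtain ⟨L, hL⟩ := ih
    beta_reduce at hL
    rcases hh.marg_insert h0 hne ht with ⟨u, hu, hmul⟩ | ⟨D, hDS, c, hcirc', hmul⟩
    · obtain ⟨x₀, hx₀⟩ := hne
      -- Each weight is a quotient of two marginals, taken at a support point.
      have hualg : ∀ s, IsAlgebraic ℚ (u s : ℂ) := fun s => by
        have h1 := hmul (update x₀ t s)
        rw [marg_update_of_notMem h ht, update_self] at h1
        have h2 : u s = marg h (insert t S) (update x₀ t s) * (marg h S x₀)⁻¹ := by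
          rw [h1, mul_right_comm, mul_inv_cancel₀ (marg_pos h0 hx₀ S).ne', one_mul]
        rw [h2, Complex.ofReal_mul, Complex.ofReal_inv]
        exact (isAlgebraic_marg halg _ _).mul (isAlgebraic_marg halg _ _).inv
      refine ⟨.unary t (fun s => (√(u s) : ℂ)) (fun s => isAlgebraic_sqrt (hu s).le (hualg s)) :: L,
        fun x => ?_⟩
      beta_reduce
      rw [List.map_cons, List.prod_cons, ← hL, hmul, Real.sqrt_mul (marg_nonneg h0 _ _),
        Complex.ofReal_mul, mul_comm]
      rfl
    · obtain ⟨φ, hφ⟩ := exists_factor_parity (fun e => ht (hDS e))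
        (not_le.1 fun h2 => hcirc D t c (hcirc' h2)) c
      refine ⟨φ :: L, fun x => ?_⟩
      beta_reduce
      rw [List.map_cons, List.prod_cons, ← hL, hmul, hφ]
      split_ifs <;> simp

end Classes

/-! ### From the square back to the function -/

section Dichotomy

theorem BoolFn.NonNeg.exists_sq_ne_zero {f : BoolFn} (hf : f.NonNeg) {x : Fin f.arity → ZMod 2}
    (hx : f.val x ≠ 0) : ∃ x, f.re x * f.re x ≠ 0 := by
  refine ⟨x, mul_self_ne_zero.2 fun h => hx ?_⟩
  rw [hf.val_eq, h, Complex.ofReal_zero]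

theorem BoolFn.NonNeg.mem_affineClass {f : BoolFn} (hf : f.NonNeg)
    (hsq : MargBlockRankOne fun x => f.re x * f.re x)
    (hskew : ∀ b, ¬ IsSkewed (fun x => f.re x * f.re x) b) : f ∈ affineClass := by
  by_cases hne : ∃ x, f.val x ≠ 0
  · obtain ⟨x₀, hx₀⟩ := hne
    obtain ⟨haff, κ, hκ⟩ := hsq.isAffineRel_and_const (fun _ => mul_self_nonneg _)
      (hf.exists_sq_ne_zero hx₀) hskew univ
    simp only [marg_univ] at haff hκ
    have hre : ∀ x, f.val x ≠ 0 ↔ f.re x * f.re x ≠ 0 := fun x => by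
      rw [hf.val_eq, Complex.ofReal_ne_zero, mul_self_ne_zero]
    -- A non-negative `f` with constant square on its support is constant there, so the zero
    -- quadratic form suffices.
    refine ⟨?_, f.val x₀, 0, 0, (hf x₀).1, fun x hx => ?_⟩
    · simpa only [supp, hre] using haff
    · have h1 := (hκ x ((hre x).1 hx)).trans (hκ x₀ ((hre x₀).1 hx₀)).symm
      rw [quadForm_zero, pow_zero, mul_one, hf.val_eq, hf.val_eq,
        (mul_self_inj (hf.re_nonneg x) (hf.re_nonneg x₀)).1 h1]
  · push Not at hne
    have hsupp : supp f.val = ∅ := by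
      ext x
      simp [supp, hne x]
    exact ⟨hsupp ▸ isAffineRel_empty, 0, 0, 0, isAlgebraic_zero, fun x hx => absurd (hne x) hx⟩

theorem BoolFn.NonNeg.mem_productClass {f : BoolFn} (hf : f.NonNeg) (hn : 1 ≤ f.arity)
    (hsq : MargBlockRankOne fun x => f.re x * f.re x)
    (hcirc : ∀ D t c, ¬ IsCircuit (fun x => f.re x * f.re x) D t c) : f ∈ productClass := by
  by_cases hne : ∃ x, f.val x ≠ 0
  · obtain ⟨x₀, hx₀⟩ := hne
    have halg : ∀ x, IsAlgebraic ℚ ((f.re x * f.re x : ℝ) : ℂ) := fun x => by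
      rw [Complex.ofReal_mul, ← hf.val_eq]
      exact (hf x).1.mul (hf x).1
    obtain ⟨L, hL⟩ := hsq.isProductType_sqrt hn (fun _ => mul_self_nonneg _) halg
      (hf.exists_sq_ne_zero hx₀) hcirc univ
    refine ⟨L, fun x => ?_⟩
    beta_reduce at hL
    rw [← hL, marg_univ, Real.sqrt_mul_self (hf.re_nonneg x), hf.val_eq]
  · push Not at hne
    exact ⟨[.unary ⟨0, hn⟩ (fun _ => 0) fun _ => isAlgebraic_zero], fun x => by
      simp [Factor.eval, hne x]⟩

end Dichotomy

end Holant

theorem mainTheorem4 (F : Set Holant.BoolFn)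
    (hpos : ∀ f ∈ F, 1 ≤ f.arity)
    (hF : ∀ f ∈ F, f.NonNeg)
    (hblock : Holant.BlockRankOneCondition F) :
    F ⊆ Holant.affineClass ∨ F ⊆ Holant.productClass := by
  by_cases h : ∃ f ∈ F, ∃ b, Holant.IsSkewed (fun x => f.re x * f.re x) b
  · obtain ⟨f, hf, b, hb⟩ := h
    exact Or.inr fun g hg => (hF g hg).mem_productClass (hpos g hg) (hblock.sq hF hg)
      fun D t c hD => Holant.not_margBlockRankOne_crossover hb hD (hblock.sq hF hg)
        (hblock.crossover hF hf hg b t)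
  · push Not at h
    exact Or.inl fun f hf => (hF f hf).mem_affineClass (hblock.sq hF hf) (h f hf)
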